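/- Consider a chain of $m+1$ nodes $0,1,\dots,m$. Node $0$ is given a uniformly random bit $\Theta\in\{0,1\}$. At each time step $i\in\{1,\dots,n\}$, each node $j\in\{0,\dots,m-1\}$ sends one bit $X_{i,j}$ to node $j+1$ through a binary symmetric channel with crossover probability $p\in(0,\tfrac12)$, whose output is $Y_{i,j}$; the channels are memoryless and independent across nodes. For $j\ge 1$ the bit $X_{i,j}$ may depend only on the previously received bits $Y_{1,j-1},\dots,Y_{i-1,j-1}$, and $X_{i,0}$ is a function of $\Theta$ (and $i$). After $n$ time steps node $m$ outputs an estimate $\hat\Theta$ computed from $Y_{1,m-1},\dots,Y_{n,m-1}$. Let $n^*(m,p)$ be the minimum $n$ for which there exists a protocol (encoding, relaying and decoding functions) with $\mathbb{P}(\hat\Theta\neq\Theta)\le\frac13$. The information velocity $v(p)=\lim_{m\to\infty}\frac{m}{n^*(m,p)}$ satisfies $v(p)=1-\Theta(p)$ as $p\to 0$, regardless of whether the limit, the $\liminf$ or the $\limsup$ is used in its definition. That is, there are constants $a,b>0$ and $p_0\in(0,\tfrac12]$ such that for all $p\in(0,p_0)$, $$1-b\,p\;\le\;\liminf_{m\to\infty}\frac{m}{n^*(m,p)}\;\le\;\limsup_{m\to\infty}\frac{m}{n^*(m,p)}\;\le\;1-a\,p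 .$$ -/

import Mathlib

open scoped ENNReal

/-- A (deterministic) protocol for relaying one bit over a chain of `m` links joining the nodes
`0, 1, …, m` in `n` time steps. Time steps are numbered `0, …, n - 1`; link `j` goes from
node `j` to node `j + 1`.

* `encode i θ` is the bit sent by node `0` (the encoder) at time `i` when the message is `θ`;
* `relay j i y` is the bit sent by the relay node `j` (`1 ≤ j < m`) at time `i` when the bits it
  received strictly before time `i` are `y 0, …, y (i - 1)` (the entry `j = 0` is not used);
* `decode y` is the estimate made by node `m` from all the `n` bits that it received. -/
structure RelayProtocol (m n : ℕ) where
  encode : Fin n → Bool → Bool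
  relay : Fin m → (i : Fin n) → (Fin i → Bool) → Bool
  decode : (Fin n → Bool) → Bool

namespace RelayProtocol

variable {m n : ℕ}

/-- `P.received θ z j _ i` is the bit received by node `j` at time `i` when the message is `θ` and
`z i j = true` means that link `j` flips the bit that it carries at time `i`.
(Node `0` is given `θ` itself.) -/
def received (P : RelayProtocol m n) (θ : Bool) (z : Fin n → Fin m → Bool) :
    (j : ℕ) → j ≤ m → Fin n → Bool
  | 0, _, _ => θ
  | 1, h, i => xor (P.encode i θ) (z i ⟨0, h⟩)
  | j + 2, h, i =>
      xor (P.relay ⟨j + 1, h⟩ i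
          (fun k : Fin i => P.received θ z (j + 1) (Nat.le_of_succ_le h) ⟨k, k.2.trans i.2⟩))
        (z i ⟨j + 1, h⟩)

/-- The estimate of the message `θ` that node `m` outputs under the noise pattern `z`. -/
def estimate (P : RelayProtocol m n) (θ : Bool) (z : Fin n → Fin m → Bool) : Bool :=
  P.decode (P.received θ z m le_rfl)

/-- The error probability: the message is uniform on `Bool`, and all the links are independent
memoryless binary symmetric channels with crossover probability `p`, i.e. the `n * m` noise bits
are independent `Bernoulli(p)` and independent of the message. -/
noncomputable def errorProb (P : RelayProtocol m n) (p : ℝ) : ℝ :=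
  ∑ θ : Bool, ∑ z : Fin n → Fin m → Bool,
    (1 / 2 : ℝ) * (∏ i, ∏ j, if z i j then p else 1 - p) *
      (if P.estimate θ z ≠ θ then 1 else 0)

end RelayProtocol

/-- The minimum block length `n` for which some protocol over `m` links has error probability at
most `1/3` (and `⊤` if there were no such `n`). -/
noncomputable def minBlockLength (m : ℕ) (p : ℝ) : ℕ∞ :=
  ⨅ (n : ℕ) (_ : ∃ P : RelayProtocol m n, P.errorProb p ≤ 1 / 3), (n : ℕ∞)

/-- The lower information velocity: the `liminf` of `m / n*(m, p)` as `m → ∞`. -/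
noncomputable def lowerVelocity (p : ℝ) : ℝ≥0∞ :=
  Filter.liminf (fun m : ℕ => (m : ℝ≥0∞) / (minBlockLength m p : ℝ≥0∞)) Filter.atTop

/-- The upper information velocity: the `limsup` of `m / n*(m, p)` as `m → ∞`. -/
noncomputable def upperVelocity (p : ℝ) : ℝ≥0∞ :=
  Filter.limsup (fun m : ℕ => (m : ℝ≥0∞) / (minBlockLength m p : ℝ≥0∞)) Filter.atTop

/-!
*Lower bound.* Relays take iterated majorities of three. A stretch of links whose relays decode
blocks of `3 ^ k` bits fails on a block only if one of a few sets of `2 ^ k` noise bits is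
completely flipped; decoding blocks of length `3 ^ (k + 1)` after it squares the failure
probability, up to a constant, because a majority of three subblocks must fail. The squared
probability pays for concatenating six times more links at level `k + 1` than at level `k`, whereas
the delay per relay is only multiplied by three, so that the total delay of all levels is a
geometric sum, of order `p` times the number of links: relays are needed only every `1 / p` links.

*Upper bound.* A binary symmetric channel is a degraded erasure channel with erasure probability
`2 * p`. Hence, if `D j i` is the `ℓ¹` distance between the laws, under the two messages, of the
first `i` bits received by node `j`, then
`D (j + 1) (i + 1) ≤ (1 - 2 * p) * D j i + 2 * p * D (j + 1) i`,
and a Chernoff bound for this random walk forces `m ≤ (1 - p) * n` for large `m`.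
-/

section Noise

/-- The probability that a `Bernoulli(p)` noise bit takes the value `b`. -/
def flipWeight (p : ℝ) (b : Bool) : ℝ := if b then p else 1 - p

theorem sum_flipWeight (p : ℝ) : ∑ b, flipWeight p b = 1 := by simp [flipWeight]

theorem flipWeight_nonneg {p : ℝ} (hp₀ : 0 ≤ p) (hp₁ : p ≤ 1) (b : Bool) : 0 ≤ flipWeight p b := by
  cases b <;> simpa [flipWeight]

theorem flipWeight_xor (p : ℝ) (a b : Bool) :
    flipWeight p (xor a b) = (1 - 2 * p) * (if a = b then 1 else 0) + p := by
  cases a <;> cases b <;> simp [flipWeight] <;> ring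

variable {ι : Type*} [Fintype ι]

/-- The probability that independent `Bernoulli(p)` noise bits take the values `z`. -/
def noiseWeight (p : ℝ) (z : ι → Bool) : ℝ := ∏ i, flipWeight p (z i)

theorem noiseWeight_nonneg {p : ℝ} (hp₀ : 0 ≤ p) (hp₁ : p ≤ 1) (z : ι → Bool) :
    0 ≤ noiseWeight p z :=
  Finset.prod_nonneg fun i _ => flipWeight_nonneg hp₀ hp₁ (z i)

theorem noiseWeight_snoc (p : ℝ) {n : ℕ} (z : Fin n → Bool) (b : Bool) :
    noiseWeight p (Fin.snoc z b : Fin (n + 1) → Bool) = noiseWeight p z * flipWeight p b := by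
  simp [noiseWeight, Fin.prod_univ_castSucc]

variable [DecidableEq ι]

theorem sum_noiseWeight (p : ℝ) : ∑ z : ι → Bool, noiseWeight p z = 1 := by
  simp only [noiseWeight]
  rw [← Fintype.prod_sum fun (_ : ι) b => flipWeight p b]
  simp only [sum_flipWeight, Finset.prod_const_one]

/-- The probability of the event `E` about independent `Bernoulli(p)` noise bits. -/
noncomputable def noiseProb (p : ℝ) (E : Set (ι → Bool)) : ℝ := ∑ z, E.indicator (noiseWeight p) z

theorem noiseProb_empty (p : ℝ) : noiseProb p (∅ : Set (ι → Bool)) = 0 := by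
  simp [noiseProb]

theorem noiseProb_forall_mem (p : ℝ) (T : Finset ι) :
    noiseProb p {z | ∀ i ∈ T, z i = true} = p ^ T.card := by
  have indicator_eq_prod (z : ι → Bool) :
      ({z | ∀ i ∈ T, z i = true} : Set (ι → Bool)).indicator (noiseWeight p) z =
        ∏ i, flipWeight p (z i) * if i ∈ T → z i = true then 1 else 0 := by
    rw [Finset.prod_mul_distrib, Finset.prod_boole]
    simp [Set.indicator_apply, noiseWeight]
  have sum_coord (i : ι) :
      ∑ b, flipWeight p b * (if i ∈ T → b = true then 1 else 0) = if i ∈ T then p else 1 := by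
    by_cases hi : i ∈ T <;> simp [hi, flipWeight]
  simp only [noiseProb, indicator_eq_prod]
  rw [← Fintype.prod_sum fun i b => flipWeight p b * if i ∈ T → b = true then 1 else 0]
  simp only [sum_coord, Finset.prod_ite_mem, Finset.univ_inter, Finset.prod_const]

theorem noiseProb_forall_mem_any_le {α : Type*} {p : ℝ} (hp : 0 ≤ p) (g : α → Option ι)
    (hg : ∀ a a' i, i ∈ g a → i ∈ g a' → a = a') (S : Finset α) :
    noiseProb p {z | ∀ a ∈ S, (g a).any z = true} ≤ p ^ S.card := by
  by_cases hS : ∀ a ∈ S, ∃ i, g a = some i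
  · choose f hf using hS
    have hinj : Function.Injective fun a : S => f a a.2 := fun a a' h =>
      Subtype.ext (hg a a' _ (hf a a.2) ((hf a' a'.2).trans (congrArg some h.symm)))
    have heq : {z : ι → Bool | ∀ a ∈ S, (g a).any z = true} =
        {z | ∀ i ∈ S.attach.image (fun a : S => f a a.2), z i = true} := by
      ext z
      simp only [Set.mem_ofPred_eq, Finset.forall_mem_image, Finset.mem_attach, forall_const,
        Subtype.forall]
      refine forall₂_congr fun a ha => ?_
      rw [hf a ha, Option.any_some]
    rw [heq, noiseProb_forall_mem, Finset.card_image_of_injective _ hinj, Finset.card_attach]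
  · push Not at hS
    obtain ⟨a, ha, hnone⟩ := hS
    have heq : {z : ι → Bool | ∀ a ∈ S, (g a).any z = true} = ∅ :=
      Set.eq_empty_of_forall_notMem fun z hz => by
        simpa [Option.eq_none_iff_forall_ne_some.2 hnone] using hz a ha
    rw [heq, noiseProb_empty]
    positivity

theorem noiseProb_le_card_mul {κ : Type*} {p ε : ℝ} (hp₀ : 0 ≤ p) (hp₁ : p ≤ 1) {F : Finset κ}
    {E : Set (ι → Bool)} {A : κ → Set (ι → Bool)} (hE : ∀ z ∈ E, ∃ S ∈ F, z ∈ A S)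
    (hA : ∀ S ∈ F, noiseProb p (A S) ≤ ε) : noiseProb p E ≤ F.card * ε := by
  have hnonneg (E : Set (ι → Bool)) (z : ι → Bool) : 0 ≤ E.indicator (noiseWeight p) z :=
    Set.indicator_nonneg (fun z _ => noiseWeight_nonneg hp₀ hp₁ z) z
  calc noiseProb p E ≤ ∑ z, ∑ S ∈ F, (A S).indicator (noiseWeight p) z := by
        refine Finset.sum_le_sum fun z _ =>
          Set.indicator_apply_le' (fun hz => ?_) fun _ => Finset.sum_nonneg fun S _ => hnonneg _ z
        obtain ⟨S, hS, hzS⟩ := hE z hz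
        rw [← Set.indicator_of_mem hzS (noiseWeight p)]
        exact Finset.single_le_sum (fun S _ => hnonneg (A S) z) hS
    _ = ∑ S ∈ F, noiseProb p (A S) := Finset.sum_comm
    _ ≤ F.card * ε := by simpa only [nsmul_eq_mul] using Finset.sum_le_card_nsmul F _ ε hA

end Noise

section IteratedMajority

/-- The majority of three bits. -/
def majority (a b c : Bool) : Bool := (a && b) || (b && c) || (a && c)

theorem two_ne_of_majority_ne {a b c x : Bool} (h : majority a b c ≠ x) :
    (a ≠ x ∧ b ≠ x) ∨ (b ≠ x ∧ c ≠ x) ∨ (a ≠ x ∧ c ≠ x) := by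
  revert a b c x
  decide

/-- The `k`-fold iterated majority of three, applied to the `c`-th block of `3 ^ k` bits of `y`. -/
def blockMajority : ℕ → (ℕ → Bool) → ℕ → Bool
  | 0, y, c => y c
  | k + 1, y, c => majority (blockMajority k y (3 * c)) (blockMajority k y (3 * c + 1))
      (blockMajority k y (3 * c + 2))

theorem div_three_pow_succ (u k : ℕ) : u / 3 ^ (k + 1) = u / 3 ^ k / 3 := by
  rw [pow_succ, Nat.div_div_eq_div_mul]

theorem blockMajority_congr {k c : ℕ} {y y' : ℕ → Bool} (h : ∀ u, u / 3 ^ k = c → y u = y' u) :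
    blockMajority k y c = blockMajority k y' c := by
  induction k generalizing c with
  | zero => exact h c (by simp)
  | succ k ih =>
    have hsub (d : ℕ) (hd : d / 3 = c) : blockMajority k y d = blockMajority k y' d :=
      ih fun u hu => h u (by rw [div_three_pow_succ, hu, hd])
    simp only [blockMajority]
    rw [hsub (3 * c) (by omega), hsub (3 * c + 1) (by omega), hsub (3 * c + 2) (by omega)]

/-- The pairs of distinct subblocks of level `k` of the `c`-th block of level `k + 1`; the level
does not enter, since blocks are numbered consecutively. -/
def subblockPairs (c : ℕ) : Finset (ℕ × ℕ) :=
  {(3 * c, 3 * c + 1), (3 * c + 1, 3 * c + 2), (3 * c, 3 * c + 2)}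

theorem of_mem_subblockPairs {c d e : ℕ} (h : (d, e) ∈ subblockPairs c) :
    d ≠ e ∧ d / 3 = c ∧ e / 3 = c := by
  simp only [subblockPairs, Finset.mem_insert, Finset.mem_singleton, Prod.mk.injEq] at h
  omega

theorem exists_mem_subblockPairs_of_blockMajority_ne {k c : ℕ} {y : ℕ → Bool} {b : Bool}
    (h : blockMajority (k + 1) y c ≠ b) :
    ∃ d e, (d, e) ∈ subblockPairs c ∧ blockMajority k y d ≠ b ∧ blockMajority k y e ≠ b := by
  rcases two_ne_of_majority_ne h with h | h | h
  · exact ⟨_, _, by simp [subblockPairs], h⟩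
  · exact ⟨_, _, by simp [subblockPairs], h⟩
  · exact ⟨_, _, by simp [subblockPairs], h⟩

end IteratedMajority

section RelayChain

/-- The stream received at the end of a chain of `ℓ.length + 1` noisy links, the first of which has
number `J`, when the stream `x` enters the chain and the successive relays replace each block of
`3 ^ q` received bits, `q` being the entry of `ℓ`, by `3 ^ q` copies of its iterated majority.
Every stream is indexed by the time elapsed since its sender started, and `ζ (J, u)` is the noise
of link `J` at elapsed time `u`. -/
def relayChain (ζ : ℕ × ℕ → Bool) : ℕ → List ℕ → (ℕ → Bool) → ℕ → Bool
  | J, [], x => fun u => xor (x u) (ζ (J, u))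
  | J, q :: ℓ, x => relayChain ζ (J + 1) ℓ
      (fun u => blockMajority q (fun v => xor (x v) (ζ (J, v))) (u / 3 ^ q))

theorem relayChain_append (ζ : ℕ × ℕ → Bool) (J : ℕ) (ℓ₁ : List ℕ) (q : ℕ) (ℓ₂ : List ℕ)
    (x : ℕ → Bool) :
    relayChain ζ J (ℓ₁ ++ q :: ℓ₂) x = relayChain ζ (J + ℓ₁.length + 1) ℓ₂
      (fun u => blockMajority q (relayChain ζ J ℓ₁ x) (u / 3 ^ q)) := by
  induction ℓ₁ generalizing J x with
  | nil => rfl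
  | cons a ℓ₁ ih =>
    simp only [List.cons_append, relayChain, ih, List.length_cons]
    congr 1
    omega

/-- `F` covers the errors of a chain on the `c`-th block of `3 ^ k` bits: whenever the bits of this
block entering the chain are equal and the block is decoded wrongly at the end, some member of `F`,
a set of `2 ^ k` noise bits of the block, is completely flipped. -/
structure IsErrorCover (k : ℕ) (ℓ : List ℕ) (J c : ℕ) (F : Finset (Finset (ℕ × ℕ))) : Prop where
  card_eq : ∀ S ∈ F, S.card = 2 ^ k
  div_eq : ∀ S ∈ F, ∀ a ∈ S, a.2 / 3 ^ k = c
  exists_flipped : ∀ (ζ : ℕ × ℕ → Bool) (x : ℕ → Bool) (b : Bool),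
    (∀ u, u / 3 ^ k = c → x u = b) → blockMajority k (relayChain ζ J ℓ x) c ≠ b →
      ∃ S ∈ F, ∀ a ∈ S, ζ a = true

theorem isErrorCover_nil (J c : ℕ) : IsErrorCover 0 [] J c {{(J, c)}} where
  card_eq := by simp
  div_eq := by simp
  exists_flipped ζ x b hx hne := by
    have hxor : xor b (ζ (J, c)) ≠ b := by simpa [blockMajority, relayChain, hx c] using hne
    cases b <;> simpa using hxor

theorem IsErrorCover.append {k J c : ℕ} {ℓ₁ ℓ₂ : List ℕ} {F₁ F₂ : Finset (Finset (ℕ × ℕ))}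
    (h₁ : IsErrorCover k ℓ₁ J c F₁) (h₂ : IsErrorCover k ℓ₂ (J + ℓ₁.length + 1) c F₂) :
    IsErrorCover k (ℓ₁ ++ k :: ℓ₂) J c (F₁ ∪ F₂) where
  card_eq := Finset.forall_mem_union.2 ⟨h₁.card_eq, h₂.card_eq⟩
  div_eq := Finset.forall_mem_union.2 ⟨h₁.div_eq, h₂.div_eq⟩
  exists_flipped ζ x b hx hne := by
    rw [relayChain_append] at hne
    by_cases hfirst : blockMajority k (relayChain ζ J ℓ₁ x) c = b
    · obtain ⟨S, hS, hflip⟩ := h₂.exists_flipped ζ _ b (fun u hu => hu ▸ hfirst) hne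
      exact ⟨S, Finset.mem_union_right _ hS, hflip⟩
    · obtain ⟨S, hS, hflip⟩ := h₁.exists_flipped ζ x b hx hfirst
      exact ⟨S, Finset.mem_union_left _ hS, hflip⟩

open scoped FinsetFamily in
theorem IsErrorCover.succ {k J c : ℕ} {ℓ : List ℕ} {F : ℕ → Finset (Finset (ℕ × ℕ))}
    (h : ∀ d, IsErrorCover k ℓ J d (F d)) :
    IsErrorCover (k + 1) ℓ J c ((subblockPairs c).biUnion fun de => F de.1 ⊻ F de.2) where
  card_eq S hS := by
    simp only [Finset.mem_biUnion, Prod.exists, Finset.mem_sups] at hS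
    obtain ⟨d, e, hde, A, hA, B, hB, rfl⟩ := hS
    have hdisj : Disjoint A B := Finset.disjoint_left.2 fun a ha hb =>
      (of_mem_subblockPairs hde).1 (((h d).div_eq A hA a ha).symm.trans ((h e).div_eq B hB a hb))
    rw [Finset.sup_eq_union, Finset.card_union_of_disjoint hdisj, (h d).card_eq A hA,
      (h e).card_eq B hB, pow_succ, mul_two]
  div_eq S hS a ha := by
    simp only [Finset.mem_biUnion, Prod.exists, Finset.mem_sups] at hS
    obtain ⟨d, e, hde, A, hA, B, hB, rfl⟩ := hS
    obtain ⟨-, hd, he⟩ := of_mem_subblockPairs hde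
    rw [div_three_pow_succ]
    rcases Finset.mem_union.1 ha with ha | ha
    · rw [(h d).div_eq A hA a ha, hd]
    · rw [(h e).div_eq B hB a ha, he]
  exists_flipped ζ x b hx hne := by
    obtain ⟨d, e, hde, hne_d, hne_e⟩ := exists_mem_subblockPairs_of_blockMajority_ne hne
    obtain ⟨-, hd, he⟩ := of_mem_subblockPairs hde
    obtain ⟨A, hA, hflipA⟩ := (h d).exists_flipped ζ x b
      (fun u hu => hx u (by rw [div_three_pow_succ, hu, hd])) hne_d
    obtain ⟨B, hB, hflipB⟩ := (h e).exists_flipped ζ x b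
      (fun u hu => hx u (by rw [div_three_pow_succ, hu, he])) hne_e
    exact ⟨A ⊔ B, Finset.mem_biUnion.2 ⟨(d, e), hde, Finset.sup_mem_sups hA hB⟩,
      Finset.forall_mem_union.2 ⟨hflipA, hflipB⟩⟩

/-- A chain is `k`-reliable with `N` witnesses if its errors on any block of `3 ^ k` bits are
covered by `N` sets of `2 ^ k` noise bits, so that it fails with probability at most
`N * p ^ 2 ^ k`. -/
def Reliable (k : ℕ) (ℓ : List ℕ) (N : ℕ) : Prop :=
  ∀ J c : ℕ, ∃ F : Finset (Finset (ℕ × ℕ)), F.card ≤ N ∧ IsErrorCover k ℓ J c F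

theorem reliable_nil : Reliable 0 [] 1 :=
  fun J c => ⟨_, (Finset.card_singleton _).le, isErrorCover_nil J c⟩

theorem Reliable.mono {k N₁ N₂ : ℕ} {ℓ : List ℕ} (h : Reliable k ℓ N₁) (hN : N₁ ≤ N₂) :
    Reliable k ℓ N₂ := fun J c =>
  let ⟨F, hcard, hF⟩ := h J c
  ⟨F, hcard.trans hN, hF⟩

theorem Reliable.append {k N₁ N₂ : ℕ} {ℓ₁ ℓ₂ : List ℕ} (h₁ : Reliable k ℓ₁ N₁)
    (h₂ : Reliable k ℓ₂ N₂) : Reliable k (ℓ₁ ++ k :: ℓ₂) (N₁ + N₂) := by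
  intro J c
  obtain ⟨F₁, hcard₁, hF₁⟩ := h₁ J c
  obtain ⟨F₂, hcard₂, hF₂⟩ := h₂ (J + ℓ₁.length + 1) c
  exact ⟨F₁ ∪ F₂, (Finset.card_union_le _ _).trans (add_le_add hcard₁ hcard₂), hF₁.append hF₂⟩

theorem Reliable.succ {k N : ℕ} {ℓ : List ℕ} (h : Reliable k ℓ N) :
    Reliable (k + 1) ℓ (3 * N ^ 2) := by
  intro J c
  choose F hcard hF using h J
  refine ⟨_, ?_, IsErrorCover.succ hF⟩
  refine (Finset.card_biUnion_le_card_mul _ _ (N ^ 2) fun de _ => ?_).trans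
    (Nat.mul_le_mul_right _ Finset.card_le_three)
  rw [sq]
  exact (Finset.card_sups_le _ _).trans (Nat.mul_le_mul (hcard _) (hcard _))

/-- The total delay of the relays of the chain `ℓ`: a relay of level `q` waits for `3 ^ q` bits. -/
def chainDelay (ℓ : List ℕ) : ℕ := (ℓ.map (3 ^ ·)).sum

theorem chainDelay_append (ℓ₁ : List ℕ) (q : ℕ) (ℓ₂ : List ℕ) :
    chainDelay (ℓ₁ ++ q :: ℓ₂) = chainDelay ℓ₁ + 3 ^ q + chainDelay ℓ₂ := by
  simp [chainDelay, add_assoc]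

theorem chainDelay_take_succ {ℓ : List ℕ} {j : ℕ} (hj : j < ℓ.length) :
    chainDelay (ℓ.take (j + 1)) = chainDelay (ℓ.take j) + 3 ^ ℓ[j] := by
  rw [← List.take_append_getElem hj, chainDelay_append]
  rfl

/-- Every number of links up to `M` is served by a chain that is `k`-reliable with `N` witnesses
and needs at most `δ` time steps more than a noiseless chain to deliver a block of `3 ^ k` bits. -/
def HasReliableChains (k N M δ : ℕ) : Prop :=
  ∀ m < M, ∃ ℓ : List ℕ, ℓ.length = m ∧ Reliable k ℓ N ∧ chainDelay ℓ + 3 ^ k ≤ m + 1 + δ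

theorem hasReliableChains_zero : HasReliableChains 0 1 1 0 := by
  intro m hm
  obtain rfl : m = 0 := by omega
  exact ⟨[], rfl, reliable_nil, le_rfl⟩

theorem HasReliableChains.mul {k N M δ : ℕ} (h : HasReliableChains k N M δ) (r : ℕ) :
    HasReliableChains k (r * N) (r * M) (r * δ) := by
  induction r with
  | zero => intro m hm; omega
  | succ r ih =>
    intro m hm
    have hM : 0 < M := Nat.pos_of_lt_mul_left hm
    rw [Nat.succ_mul] at hm
    rw [Nat.succ_mul, Nat.succ_mul]
    rcases lt_or_ge m M with hmM | hMm
    · obtain ⟨ℓ, hlen, hrel, hdelay⟩ := h m hmM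
      exact ⟨ℓ, hlen, hrel.mono (by omega), by omega⟩
    · obtain ⟨ℓ₁, hlen₁, hrel₁, hdelay₁⟩ := ih (m - M) (by omega)
      obtain ⟨ℓ₂, hlen₂, hrel₂, hdelay₂⟩ := h (M - 1) (by omega)
      refine ⟨ℓ₁ ++ k :: ℓ₂, ?_, hrel₁.append hrel₂, ?_⟩
      · simp only [List.length_append, List.length_cons]
        omega
      · rw [chainDelay_append]
        omega

theorem HasReliableChains.succ {k N M δ : ℕ} (h : HasReliableChains k N M δ) :
    HasReliableChains (k + 1) (3 * N ^ 2) M (δ + 2 * 3 ^ k) := by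
  intro m hm
  obtain ⟨ℓ, hlen, hrel, hdelay⟩ := h m hm
  exact ⟨ℓ, hlen, hrel.succ, by rw [pow_succ]; omega⟩

/- Since `108 = 3 * 6 ^ 2`, the failure probability `ε` of a chain becomes `108 * ε ^ 2` when six
copies are concatenated and the level is raised; `1 / 108` is the fixed point of this map. -/
theorem exists_hasReliableChains {p : ℝ} (hp : 0 ≤ p) {R : ℕ} (hRp : R * p ≤ 1 / 18) (k : ℕ) :
    ∃ N δ : ℕ, N * p ^ 2 ^ (k + 1) ≤ 1 / 108 ∧ δ + 2 * 3 ^ k = 4 * 6 ^ k ∧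
      HasReliableChains (k + 1) N (R * 6 ^ k) δ := by
  induction k with
  | zero =>
    refine ⟨_, _, ?_, ?_, by simpa using (hasReliableChains_zero.mul R).succ⟩
    · calc ((3 * R ^ 2 : ℕ) : ℝ) * p ^ 2 ^ (0 + 1) = 3 * (R * p) ^ 2 := by push_cast; ring
        _ ≤ 3 * (1 / 18) ^ 2 := by gcongr
        _ = 1 / 108 := by norm_num
    · norm_num
  | succ k ih =>
    obtain ⟨N, δ, hN, hδ, hchains⟩ := ih
    refine ⟨3 * (6 * N) ^ 2, 6 * δ + 2 * 3 ^ (k + 1), ?_, by omega, ?_⟩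
    · calc ((3 * (6 * N) ^ 2 : ℕ) : ℝ) * p ^ 2 ^ (k + 1 + 1)
          = 108 * (N * p ^ 2 ^ (k + 1)) ^ 2 := by
            rw [pow_succ 2 (k + 1), pow_mul]
            push_cast
            ring
        _ ≤ 108 * (1 / 108) ^ 2 := by gcongr
        _ = 1 / 108 := by norm_num
    · have hlen : R * 6 ^ (k + 1) = 6 * (R * 6 ^ k) := by ring
      rw [hlen]
      exact (hchains.mul 6).succ

end RelayChain

section MajorityProtocol

/-- The stream `y s, y (s + 1), …`, continued by `false` when the bits of `y` are exhausted. -/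
def shiftStream {i : ℕ} (s : ℕ) (y : Fin i → Bool) (u : ℕ) : Bool :=
  if h : s + u < i then y ⟨s + u, h⟩ else false

theorem shiftStream_of_lt {i s u : ℕ} (y : Fin i → Bool) (h : s + u < i) :
    shiftStream s y u = y ⟨s + u, h⟩ :=
  dif_pos h

/-- The protocol in which the relays act as in `relayChain` and the last node outputs the iterated
majority of the first `3 ^ k` bits that it receives after the delay of the chain. Node `j` starts to
send at time `chainDelay (ℓ.take j)`. -/
def majorityProtocol (ℓ : List ℕ) (k n : ℕ) : RelayProtocol (ℓ.length + 1) n where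
  encode _ θ := θ
  relay j i y := blockMajority (ℓ.getD (j - 1) 0) (shiftStream (chainDelay (ℓ.take (j - 1))) y)
    ((i - chainDelay (ℓ.take j)) / 3 ^ ℓ.getD (j - 1) 0)
  decode y := blockMajority k (shiftStream (chainDelay ℓ) y) 0

/-- The position, among the noise bits of a protocol, of the noise bit of link `a.1` at the time
`a.2` after its sender started, if this is within the range of the protocol. -/
def noiseIndex (ℓ : List ℕ) (n : ℕ) (a : ℕ × ℕ) : Option (Fin n × Fin (ℓ.length + 1)) :=
  if h : chainDelay (ℓ.take a.1) + a.2 < n ∧ a.1 < ℓ.length + 1 then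
    some (⟨_, h.1⟩, ⟨_, h.2⟩) else none

theorem noiseIndex_inj {ℓ : List ℕ} {n : ℕ} (a a' : ℕ × ℕ) (i : Fin n × Fin (ℓ.length + 1))
    (h : i ∈ noiseIndex ℓ n a) (h' : i ∈ noiseIndex ℓ n a') : a = a' := by
  simp only [noiseIndex, Option.mem_def, Option.dite_none_right_eq_some, Option.some.injEq] at h h'
  obtain ⟨_, hi⟩ := h
  obtain ⟨_, hi'⟩ := h'
  have heq := hi.trans hi'.symm
  simp only [Prod.mk.injEq, Fin.mk.injEq] at heq
  obtain ⟨htime, hlink⟩ := heq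
  rw [hlink, Nat.add_left_cancel_iff] at htime
  exact Prod.ext hlink htime

/-- The noise bits of a protocol, indexed as in `relayChain`. -/
def elapsedNoise (ℓ : List ℕ) {n : ℕ} (z : Fin n × Fin (ℓ.length + 1) → Bool) (a : ℕ × ℕ) : Bool :=
  (noiseIndex ℓ n a).any z

variable {ℓ : List ℕ} {n : ℕ} (k : ℕ) (θ : Bool) (z : Fin n × Fin (ℓ.length + 1) → Bool)

theorem elapsedNoise_of_lt {j u : ℕ} (hu : chainDelay (ℓ.take j) + u < n)
    (hj : j < ℓ.length + 1) : elapsedNoise ℓ z (j, u) = z (⟨_, hu⟩, ⟨j, hj⟩) := by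
  simp [elapsedNoise, noiseIndex, hu, hj]

theorem lt_add_of_div_eq_div {u v d : ℕ} (hd : 0 < d) (h : v / d = u / d) : v < u + d :=
  calc v < d * (v / d + 1) := Nat.lt_mul_div_succ v hd
    _ = d * (u / d) + d := by rw [h, mul_add_one]
    _ ≤ u + d := Nat.add_le_add_right (Nat.mul_div_le u d) d

theorem received_majorityProtocol {j u : ℕ} (hj : j + 1 ≤ ℓ.length + 1)
    (hu : chainDelay (ℓ.take j) + u < n) :
    (majorityProtocol ℓ k n).received θ (Function.curry z) (j + 1) hj ⟨_, hu⟩ =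
      relayChain (elapsedNoise ℓ z) 0 (ℓ.take j) (fun _ => θ) u := by
  induction j generalizing u with
  | zero =>
    exact congrArg (xor θ) (elapsedNoise_of_lt z hu hj).symm
  | succ j ih =>
    have hjℓ : j < ℓ.length := by omega
    have hlevel : ℓ.getD j 0 = ℓ[j] := by simp [hjℓ]
    have hdelay := chainDelay_take_succ hjℓ
    have hchain : relayChain (elapsedNoise ℓ z) 0 (ℓ.take (j + 1)) (fun _ => θ) u =
        xor (blockMajority ℓ[j] (relayChain (elapsedNoise ℓ z) 0 (ℓ.take j) fun _ => θ)
          (u / 3 ^ ℓ[j])) (elapsedNoise ℓ z (j + 1, u)) := by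
      rw [← List.take_append_getElem hjℓ, relayChain_append, relayChain, List.length_take,
        min_eq_left hjℓ.le, zero_add]
    rw [hchain, RelayProtocol.received, elapsedNoise_of_lt z hu hj]
    refine congrArg₂ xor ?_ rfl
    change blockMajority (ℓ.getD j 0) _
      ((chainDelay (ℓ.take (j + 1)) + u - chainDelay (ℓ.take (j + 1))) / 3 ^ ℓ.getD j 0) = _
    rw [hlevel, Nat.add_sub_cancel_left]
    refine blockMajority_congr fun v hv => ?_
    have hvu : v < u + 3 ^ ℓ[j] := lt_add_of_div_eq_div (by positivity) hv
    have hlt : chainDelay (ℓ.take j) + v < chainDelay (ℓ.take (j + 1)) + u := by omega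
    exact (shiftStream_of_lt _ hlt).trans (ih (by omega) (by omega))

theorem estimate_majorityProtocol (hn : chainDelay ℓ + 3 ^ k ≤ n) :
    (majorityProtocol ℓ k n).estimate θ (Function.curry z) =
      blockMajority k (relayChain (elapsedNoise ℓ z) 0 ℓ fun _ => θ) 0 := by
  refine blockMajority_congr fun u hu => ?_
  have hu' : u < 3 ^ k := (Nat.div_eq_zero_iff_lt (by positivity)).1 hu
  have hreceived := received_majorityProtocol k θ z (j := ℓ.length) (u := u) le_rfl
    (by rw [List.take_length]; omega)
  rw [shiftStream_of_lt _ (by omega)]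
  simpa only [List.take_length] using hreceived

end MajorityProtocol

theorem RelayProtocol.errorProb_eq_sum_noiseProb {m n : ℕ} (P : RelayProtocol m n) (p : ℝ) :
    P.errorProb p = ∑ θ : Bool,
      1 / 2 * noiseProb p {z : Fin n × Fin m → Bool | P.estimate θ (Function.curry z) ≠ θ} := by
  refine Finset.sum_congr rfl fun θ _ => ?_
  rw [← Equiv.sum_comp (Equiv.curry (Fin n) (Fin m) Bool), noiseProb, Finset.mul_sum]
  refine Finset.sum_congr rfl fun z _ => ?_
  simp only [Set.indicator_apply, Set.mem_ofPred_eq, noiseWeight, flipWeight,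
    Fintype.prod_prod_type, Equiv.curry_apply, Function.curry_apply, mul_ite, mul_one, mul_zero]

theorem errorProb_majorityProtocol_le {p : ℝ} (hp₀ : 0 ≤ p) (hp₁ : p ≤ 1) {ℓ : List ℕ}
    {k n N : ℕ} (hℓ : Reliable k ℓ N) (hn : chainDelay ℓ + 3 ^ k ≤ n) :
    (majorityProtocol ℓ k n).errorProb p ≤ N * p ^ 2 ^ k := by
  obtain ⟨F, hcard, hF⟩ := hℓ 0 0
  have herror (θ : Bool) : noiseProb p {z : Fin n × Fin (ℓ.length + 1) → Bool |
      (majorityProtocol ℓ k n).estimate θ (Function.curry z) ≠ θ} ≤ N * p ^ 2 ^ k := by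
    refine (noiseProb_le_card_mul (F := F) (A := fun S => {z | ∀ a ∈ S, elapsedNoise ℓ z a = true})
      hp₀ hp₁ (fun z hz => ?_) fun S hS => ?_).trans (by gcongr)
    · rw [Set.mem_ofPred_eq, estimate_majorityProtocol k θ z hn] at hz
      exact hF.exists_flipped _ _ θ (fun _ _ => rfl) hz
    · rw [← hF.card_eq S hS]
      exact noiseProb_forall_mem_any_le hp₀ _ noiseIndex_inj S
  calc (majorityProtocol ℓ k n).errorProb p ≤ ∑ _θ : Bool, 1 / 2 * (N * p ^ 2 ^ k) := by
        rw [RelayProtocol.errorProb_eq_sum_noiseProb]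
        gcongr with θ
        exact herror θ
    _ = N * p ^ 2 ^ k := by rw [Fintype.sum_bool]; ring

theorem exists_protocol_of_mul_le {p : ℝ} (hp : 0 ≤ p) {R m : ℕ} (hR : 1 ≤ R)
    (hRp : R * p ≤ 1 / 18) (hRm : R ≤ m) :
    ∃ P : RelayProtocol (m + 1) (m + 1 + 24 * (m / R)), P.errorProb p ≤ 1 / 3 := by
  have hp₁ : p ≤ 1 := by
    have : p ≤ R * p := le_mul_of_one_le_left hp (by exact_mod_cast hR)
    linarith
  set K := Nat.log 6 (m / R) with hK
  have hlower : 6 ^ K ≤ m / R := Nat.pow_log_le_self 6 (Nat.div_pos hRm hR).ne'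
  have hupper : m < R * 6 ^ (K + 1) := by
    rw [mul_comm, ← Nat.div_lt_iff_lt_mul hR]
    exact Nat.lt_pow_succ_log_self (by norm_num) _
  obtain ⟨N, δ, hN, hδ, hchains⟩ := exists_hasReliableChains hp hRp (K + 1)
  obtain ⟨ℓ, hlen, hrel, hdelay⟩ := hchains m hupper
  clear_value K
  subst hlen
  have hn : chainDelay ℓ + 3 ^ (K + 1 + 1) ≤ ℓ.length + 1 + 24 * (ℓ.length / R) := by
    rw [pow_succ 6] at hδ
    omega
  exact ⟨majorityProtocol ℓ (K + 1 + 1) _, (errorProb_majorityProtocol_le hp hp₁ hrel hn).trans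
    (hN.trans (by norm_num))⟩

/- With relays every `R ≈ 1 / (18 * p)` links, the delay `24 * m / R` is at most `864 * p * m`. -/
theorem eventually_exists_protocol {p : ℝ} (hp : 0 < p) (hp18 : p ≤ 1 / 18) :
    ∀ᶠ m : ℕ in Filter.atTop, ∃ n : ℕ, (∃ P : RelayProtocol m n, P.errorProb p ≤ 1 / 3) ∧
      (n : ℝ) ≤ (1 + 864 * p) * m := by
  set x := 1 / (18 * p) with hx
  have hx₁ : 1 ≤ x := by rw [hx, le_div_iff₀ (by positivity)]; linarith
  have hR : 1 ≤ ⌊x⌋₊ := Nat.le_floor (by exact_mod_cast hx₁)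
  have hxp : x * p = 1 / 18 := by rw [hx]; field_simp
  have hRp : ⌊x⌋₊ * p ≤ 1 / 18 := hxp ▸ by gcongr; exact Nat.floor_le (by positivity)
  filter_upwards [Filter.eventually_gt_atTop ⌊x⌋₊] with m hm
  obtain ⟨m, rfl⟩ := Nat.exists_eq_add_one.2 (Nat.zero_lt_of_lt hm)
  refine ⟨_, exists_protocol_of_mul_le hp.le hR hRp (Nat.le_of_lt_succ hm), ?_⟩
  have hdiv : ((m / ⌊x⌋₊ : ℕ) : ℝ) ≤ 36 * p * m :=
    calc ((m / ⌊x⌋₊ : ℕ) : ℝ) ≤ m / ⌊x⌋₊ := Nat.cast_div_le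
      _ ≤ m / (x / 2) := by
        gcongr
        exact (Nat.div_two_lt_floor hx₁).le
      _ = 36 * p * m := by rw [hx]; field_simp; ring
  push_cast at hdiv ⊢
  linarith

section BinarySymmetricLink

/-- A deterministic rule for the next bit to send, given the bits received so far. -/
abbrev Strategy := (i : ℕ) → (Fin i → Bool) → Bool

/-- Real weights on the bit strings of each length, such as the laws of the prefixes of a random
sequence or the differences of two such families of laws. -/
abbrev PrefixFamily := (i : ℕ) → (Fin i → Bool) → ℝ

/-- The bits received over a link with noise `e` from a node that uses `r` and receives `y`. -/
def linkOutput (r : Strategy) {n : ℕ} (y e : Fin n → Bool) : Fin n → Bool :=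
  fun i => xor (r i fun t => y ⟨t, t.2.trans i.2⟩) (e i)

theorem linkOutput_involutive (r : Strategy) {n : ℕ} (y : Fin n → Bool) :
    Function.Involutive (linkOutput r y) := fun e => by
  funext i
  simp [linkOutput]

theorem linkOutput_snoc (r : Strategy) {n : ℕ} (y e : Fin n → Bool) (a b : Bool) :
    linkOutput r (Fin.snoc y a : Fin (n + 1) → Bool) (Fin.snoc e b) =
      Fin.snoc (linkOutput r y e) (xor (r n y) b) := by
  funext i
  cases i using Fin.lastCases with
  | last => simp [linkOutput, Fin.snoc]
  | cast i => simp [linkOutput, Fin.snoc, fun t : Fin i => t.2.trans i.2]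

/-- The probability of receiving `y'` over a binary symmetric channel from a node that uses `r` and
receives `y`. The noise must be the difference of `y'` and the bits sent. -/
def linkKernel (p : ℝ) (r : Strategy) {n : ℕ} (y y' : Fin n → Bool) : ℝ :=
  noiseWeight p (linkOutput r y y')

theorem linkKernel_nonneg {p : ℝ} (hp₀ : 0 ≤ p) (hp₁ : p ≤ 1) (r : Strategy) {n : ℕ}
    (y y' : Fin n → Bool) : 0 ≤ linkKernel p r y y' :=
  noiseWeight_nonneg hp₀ hp₁ _

theorem linkKernel_snoc (p : ℝ) (r : Strategy) {n : ℕ} (y y' : Fin n → Bool) (a b : Bool) :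
    linkKernel p r (Fin.snoc y a : Fin (n + 1) → Bool) (Fin.snoc y' b) =
      linkKernel p r y y' * flipWeight p (xor (r n y) b) := by
  rw [linkKernel, linkOutput_snoc, noiseWeight_snoc, linkKernel]

theorem sum_noiseWeight_mul_linkOutput (p : ℝ) (r : Strategy) {n : ℕ} (y : Fin n → Bool)
    (f : (Fin n → Bool) → ℝ) :
    ∑ e, noiseWeight p e * f (linkOutput r y e) = ∑ y', linkKernel p r y y' * f y' := by
  rw [← Equiv.sum_comp (linkOutput_involutive r y).toPerm]
  simp only [Function.Involutive.coe_toPerm, linkOutput_involutive r y _, linkKernel]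

theorem sum_linkKernel (p : ℝ) (r : Strategy) {n : ℕ} (y : Fin n → Bool) :
    ∑ y', linkKernel p r y y' = 1 := by
  simpa [sum_noiseWeight] using (sum_noiseWeight_mul_linkOutput p r y 1).symm

theorem sum_fin_succ_fun {α M : Type*} [Fintype α] [AddCommMonoid M] {n : ℕ}
    (f : (Fin (n + 1) → α) → M) : ∑ y, f y = ∑ y : Fin n → α, ∑ b, f (Fin.snoc y b) := by
  rw [← Equiv.sum_comp (Fin.snocEquiv fun _ : Fin (n + 1) => α), Fintype.sum_prod_type,
    Finset.sum_comm]
  rfl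

/-- A family is consistent if each of its members is the marginal of the next one. -/
def PrefixConsistent (δ : PrefixFamily) : Prop :=
  ∀ i y, ∑ b, δ (i + 1) (Fin.snoc y b) = δ i y

theorem PrefixConsistent.sub {δ δ' : PrefixFamily} (h : PrefixConsistent δ)
    (h' : PrefixConsistent δ') : PrefixConsistent (δ - δ') := fun i y => by
  simp only [Pi.sub_apply, Finset.sum_sub_distrib, h i y, h' i y]

/-- The `ℓ¹` norm of the `i`-th member of a family. -/
def prefixNorm (δ : PrefixFamily) (i : ℕ) : ℝ := ∑ y, |δ i y|

/-- The weights of the received prefixes after a binary symmetric link, given those before it. -/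
def linkPush (p : ℝ) (r : Strategy) (δ : PrefixFamily) : PrefixFamily :=
  fun i y' => ∑ y, δ i y * linkKernel p r y y'

/-- The joint weight of the prefix `y'` received over a link and the next bit `b` sent over it. -/
def linkJoint (p : ℝ) (r : Strategy) (δ : PrefixFamily) {i : ℕ} (y' : Fin i → Bool) (b : Bool) :
    ℝ :=
  ∑ y, δ i y * linkKernel p r y y' * if r i y = b then 1 else 0

theorem linkPush_sub (p : ℝ) (r : Strategy) (δ δ' : PrefixFamily) :
    linkPush p r (δ - δ') = linkPush p r δ - linkPush p r δ' := by
  funext i y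
  simp [linkPush, sub_mul]

theorem sum_linkPush (p : ℝ) (r : Strategy) (δ : PrefixFamily) (i : ℕ) :
    ∑ y', linkPush p r δ i y' = ∑ y, δ i y := by
  simp only [linkPush]
  rw [Finset.sum_comm]
  simp only [← Finset.mul_sum, sum_linkKernel, mul_one]

theorem sum_linkJoint (p : ℝ) (r : Strategy) (δ : PrefixFamily) {i : ℕ} (y' : Fin i → Bool) :
    ∑ b, linkJoint p r δ y' b = linkPush p r δ i y' := by
  simp only [linkJoint, linkPush]
  rw [Finset.sum_comm]
  simp only [← Finset.mul_sum, Finset.sum_ite_eq, Finset.mem_univ, if_true, mul_one]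

theorem sum_abs_linkJoint_le {p : ℝ} (hp₀ : 0 ≤ p) (hp₁ : p ≤ 1) (r : Strategy) (δ : PrefixFamily)
    (i : ℕ) : ∑ y' : Fin i → Bool, ∑ b, |linkJoint p r δ y' b| ≤ prefixNorm δ i := by
  have habs (y' : Fin i → Bool) (b : Bool) :
      |linkJoint p r δ y' b| ≤ linkJoint p r (fun i y => |δ i y|) y' b := by
    refine (Finset.abs_sum_le_sum_abs _ _).trans (Finset.sum_le_sum fun y _ => ?_)
    have hindicator : (0 : ℝ) ≤ if r i y = b then 1 else 0 := by positivity
    rw [abs_mul, abs_mul, abs_of_nonneg (linkKernel_nonneg hp₀ hp₁ r y y'),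
      abs_of_nonneg hindicator]
  calc ∑ y' : Fin i → Bool, ∑ b, |linkJoint p r δ y' b|
      ≤ ∑ y' : Fin i → Bool, ∑ b, linkJoint p r (fun i y => |δ i y|) y' b :=
        Finset.sum_le_sum fun y' _ => Finset.sum_le_sum fun b _ => habs y' b
    _ = prefixNorm δ i := by simp only [sum_linkJoint, sum_linkPush, prefixNorm]

theorem linkPush_snoc (p : ℝ) (r : Strategy) {δ : PrefixFamily} (hδ : PrefixConsistent δ) {i : ℕ}
    (y' : Fin i → Bool) (b : Bool) :
    linkPush p r δ (i + 1) (Fin.snoc y' b) =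
      (1 - 2 * p) * linkJoint p r δ y' b + p * linkPush p r δ i y' := by
  rw [linkPush, sum_fin_succ_fun]
  simp only [linkKernel_snoc, ← Finset.sum_mul, hδ i _, linkPush, linkJoint, Finset.mul_sum,
    ← Finset.sum_add_distrib, flipWeight_xor]
  exact Finset.sum_congr rfl fun y _ => by ring

theorem PrefixConsistent.linkPush {δ : PrefixFamily} (hδ : PrefixConsistent δ) (p : ℝ)
    (r : Strategy) : PrefixConsistent (linkPush p r δ) := fun i y' => by
  simp only [linkPush_snoc p r hδ, Finset.sum_add_distrib, ← Finset.mul_sum, sum_linkJoint,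
    Finset.sum_const, Finset.card_univ, Fintype.card_bool]
  ring

theorem prefixNorm_linkPush_succ_le {p : ℝ} (hp₀ : 0 ≤ p) (hp₂ : p ≤ 1 / 2) (r : Strategy)
    {δ : PrefixFamily} (hδ : PrefixConsistent δ) (i : ℕ) :
    prefixNorm (linkPush p r δ) (i + 1) ≤
      (1 - 2 * p) * prefixNorm δ i + 2 * p * prefixNorm (linkPush p r δ) i := by
  have h2p : 0 ≤ 1 - 2 * p := by linarith
  have hnext (y' : Fin i → Bool) (b : Bool) : |linkPush p r δ (i + 1) (Fin.snoc y' b)| ≤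
      (1 - 2 * p) * |linkJoint p r δ y' b| + p * |linkPush p r δ i y'| := by
    rw [linkPush_snoc p r hδ]
    refine (abs_add_le _ _).trans_eq ?_
    rw [abs_mul, abs_mul, abs_of_nonneg h2p, abs_of_nonneg hp₀]
  calc prefixNorm (linkPush p r δ) (i + 1)
      ≤ ∑ y' : Fin i → Bool, ∑ b,
          ((1 - 2 * p) * |linkJoint p r δ y' b| + p * |linkPush p r δ i y'|) := by
        rw [prefixNorm, sum_fin_succ_fun]
        exact Finset.sum_le_sum fun y' _ => Finset.sum_le_sum fun b _ => hnext y' b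
    _ = (1 - 2 * p) * ∑ y' : Fin i → Bool, ∑ b, |linkJoint p r δ y' b| +
          2 * p * prefixNorm (linkPush p r δ) i := by
        simp only [Finset.sum_add_distrib, ← Finset.mul_sum, Finset.sum_const, Finset.card_univ,
          Fintype.card_bool, nsmul_eq_mul, prefixNorm]
        push_cast
        ring
    _ ≤ (1 - 2 * p) * prefixNorm δ i + 2 * p * prefixNorm (linkPush p r δ) i := by
        gcongr
        exact sum_abs_linkJoint_le hp₀ (by linarith) r δ i

end BinarySymmetricLink

section PrefixLaw

/-- The laws of the prefixes of the bits received by node `j`, if node `0` receives only bits `θ`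
and node `l` uses the strategy `r l`. -/
def prefixLaw (p : ℝ) (r : ℕ → Strategy) (θ : Bool) : ℕ → PrefixFamily
  | 0 => fun _ y => if y = fun _ => θ then 1 else 0
  | j + 1 => linkPush p (r j) (prefixLaw p r θ j)

theorem prefixConsistent_prefixLaw (p : ℝ) (r : ℕ → Strategy) (θ : Bool) (j : ℕ) :
    PrefixConsistent (prefixLaw p r θ j) := by
  induction j with
  | zero =>
    intro i y
    have hsnoc (b : Bool) : ((Fin.snoc y b : Fin (i + 1) → Bool) = fun _ => θ) ↔
        (y = fun _ => θ) ∧ b = θ := by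
      simp [funext_iff, Fin.forall_fin_succ']
    simp only [prefixLaw, hsnoc]
    by_cases hy : y = fun _ => θ <;> simp [hy]
  | succ j ih => exact ih.linkPush p (r j)

theorem prefixLaw_nonneg {p : ℝ} (hp₀ : 0 ≤ p) (hp₁ : p ≤ 1) (r : ℕ → Strategy) (θ : Bool)
    (j i : ℕ) (y : Fin i → Bool) : 0 ≤ prefixLaw p r θ j i y := by
  induction j generalizing y with
  | zero => exact ite_nonneg zero_le_one le_rfl
  | succ j ih =>
    exact Finset.sum_nonneg fun y' _ => mul_nonneg (ih y') (linkKernel_nonneg hp₀ hp₁ _ _ _)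

theorem sum_prefixLaw (p : ℝ) (r : ℕ → Strategy) (θ : Bool) (j i : ℕ) :
    ∑ y, prefixLaw p r θ j i y = 1 := by
  induction j with
  | zero => simp [prefixLaw]
  | succ j ih => rw [prefixLaw, sum_linkPush, ih]

theorem prefixNorm_prefixLaw_sub_le_two {p : ℝ} (hp₀ : 0 ≤ p) (hp₁ : p ≤ 1) (r r' : ℕ → Strategy)
    (θ θ' : Bool) (j i : ℕ) : prefixNorm (prefixLaw p r θ j - prefixLaw p r' θ' j) i ≤ 2 :=
  calc prefixNorm (prefixLaw p r θ j - prefixLaw p r' θ' j) i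
      ≤ ∑ y, (prefixLaw p r θ j i y + prefixLaw p r' θ' j i y) := by
        refine Finset.sum_le_sum fun y _ => (abs_sub _ _).trans_eq ?_
        rw [abs_of_nonneg (prefixLaw_nonneg hp₀ hp₁ r θ j i y),
          abs_of_nonneg (prefixLaw_nonneg hp₀ hp₁ r' θ' j i y)]
    _ = 2 := by rw [Finset.sum_add_distrib, sum_prefixLaw, sum_prefixLaw, one_add_one_eq_two]

theorem prefixNorm_prefixLaw_sub_zero (p : ℝ) (r r' : ℕ → Strategy) (θ θ' : Bool) (j : ℕ) :
    prefixNorm (prefixLaw p r θ j - prefixLaw p r' θ' j) 0 = 0 := by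
  have hsum := (sum_prefixLaw p r θ j 0).trans (sum_prefixLaw p r' θ' j 0).symm
  rw [Fintype.sum_unique, Fintype.sum_unique] at hsum
  simp only [prefixNorm, Fintype.sum_unique, Pi.sub_apply, hsum, sub_self, abs_zero]

theorem le_mul_pow_mul_pow_of_recurrence {a : ℕ → ℕ → ℝ} {C α β x y : ℝ} (hC : 0 ≤ C) (hα : 0 ≤ α)
    (hβ : 0 ≤ β) (hx : 0 ≤ x) (hy : 1 ≤ y) (hxy : α + β * x ≤ x * y) (h₀ : ∀ i, a 0 i ≤ C)
    (hzero : ∀ j, a (j + 1) 0 ≤ 0)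
    (hsucc : ∀ j i, a (j + 1) (i + 1) ≤ α * a j i + β * a (j + 1) i) (j i : ℕ) :
    a j i ≤ C * x ^ j * y ^ i := by
  induction j generalizing i with
  | zero =>
    rw [pow_zero, mul_one]
    exact (h₀ i).trans (le_mul_of_one_le_right hC (one_le_pow₀ hy))
  | succ j ihj =>
    induction i with
    | zero => exact (hzero j).trans (by positivity)
    | succ i ihi =>
      calc a (j + 1) (i + 1) ≤ α * a j i + β * a (j + 1) i := hsucc j i
        _ ≤ α * (C * x ^ j * y ^ i) + β * (C * x ^ (j + 1) * y ^ i) := by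
          gcongr
          exact ihj i
        _ = C * x ^ j * y ^ i * (α + β * x) := by ring
        _ ≤ C * x ^ j * y ^ i * (x * y) := by gcongr
        _ = C * x ^ (j + 1) * y ^ (i + 1) := by ring

theorem prefixNorm_prefixLaw_sub_le {p : ℝ} (hp₀ : 0 ≤ p) (hp₂ : p ≤ 1 / 2) {r r' : ℕ → Strategy}
    (hr : ∀ j, r (j + 1) = r' (j + 1)) (θ θ' : Bool) (j i : ℕ) :
    prefixNorm (prefixLaw p r θ (j + 1) - prefixLaw p r' θ' (j + 1)) i ≤
      2 * (1 / (1 + p)) ^ j * (1 + p - 2 * p ^ 2) ^ i := by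
  refine le_mul_pow_mul_pow_of_recurrence
    (a := fun j => prefixNorm (prefixLaw p r θ (j + 1) - prefixLaw p r' θ' (j + 1)))
    (α := 1 - 2 * p) (β := 2 * p) zero_le_two (by linarith) (by linarith) (by positivity)
    (by nlinarith) (le_of_eq (by field_simp; ring))
    (fun i => prefixNorm_prefixLaw_sub_le_two hp₀ (by linarith) r r' θ θ' 1 i)
    (fun j => (prefixNorm_prefixLaw_sub_zero p r r' θ θ' _).le) (fun j i => ?_) j i
  have hpush : prefixLaw p r θ (j + 1 + 1) - prefixLaw p r' θ' (j + 1 + 1) =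
      linkPush p (r (j + 1)) (prefixLaw p r θ (j + 1) - prefixLaw p r' θ' (j + 1)) := by
    rw [linkPush_sub, prefixLaw.eq_2 p r, prefixLaw.eq_2 p r', hr]
  rw [hpush]
  exact prefixNorm_linkPush_succ_le hp₀ hp₂ _ ((prefixConsistent_prefixLaw p r θ _).sub
    (prefixConsistent_prefixLaw p r' θ' _)) i

end PrefixLaw

section Converse

/-- The bits received by node `j` when node `0` receives `x`, node `l` uses the strategy `r l`, and
`e l` is the noise of link `l`. -/
def nodeReceived (r : ℕ → Strategy) {n : ℕ} (x : Fin n → Bool) :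
    (j : ℕ) → (Fin j → Fin n → Bool) → Fin n → Bool
  | 0, _ => x
  | j + 1, e => linkOutput (r j) (nodeReceived r x j (Fin.init e)) (e (Fin.last j))

theorem sum_noiseWeight_mul_nodeReceived (p : ℝ) (r : ℕ → Strategy) (θ : Bool) {n : ℕ} (j : ℕ)
    (f : (Fin n → Bool) → ℝ) :
    ∑ e : Fin j → Fin n → Bool, (∏ l, noiseWeight p (e l)) * f (nodeReceived r (fun _ => θ) j e) =
      ∑ y, prefixLaw p r θ j n y * f y := by
  induction j generalizing f with
  | zero => simp [nodeReceived, prefixLaw]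
  | succ j ih =>
    rw [sum_fin_succ_fun]
    simp only [Fin.prod_univ_castSucc, Fin.snoc_castSucc, Fin.snoc_last, nodeReceived,
      Fin.init_snoc, mul_assoc, ← Finset.mul_sum, sum_noiseWeight_mul_linkOutput]
    rw [ih fun y => ∑ y', linkKernel p (r j) y y' * f y']
    simp only [prefixLaw, linkPush, Finset.mul_sum, Finset.sum_mul, mul_assoc]
    exact Finset.sum_comm

namespace RelayProtocol

variable {m n : ℕ}

/-- The strategies of all the nodes when the message is `θ`. They are continued by `false` beyond
the range of the protocol. -/
def strategy (P : RelayProtocol m n) (θ : Bool) : ℕ → Strategy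
  | 0, i, _ => if h : i < n then P.encode ⟨i, h⟩ θ else false
  | j + 1, i, y => if h : j + 1 < m ∧ i < n then P.relay ⟨j + 1, h.1⟩ ⟨i, h.2⟩ y else false

theorem received_eq_nodeReceived (P : RelayProtocol m n) (θ : Bool) (z : Fin n → Fin m → Bool)
    {j : ℕ} (hj : j ≤ m) : P.received θ z j hj =
      nodeReceived (P.strategy θ) (fun _ => θ) j (fun l i => z i ⟨l, l.2.trans_le hj⟩) := by
  induction j with
  | zero => rfl
  | succ j ih =>
    funext i
    cases j with
    | zero => simp [received, nodeReceived, linkOutput, strategy]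
    | succ j =>
      rw [received, ih (Nat.le_of_succ_le hj), nodeReceived.eq_2 _ _ (j + 1), linkOutput]
      have hrelay : j + 1 < m := hj
      simp only [strategy, hrelay, i.2, and_self, dif_pos]
      rfl

theorem errorProb_eq_sum_prefixLaw (P : RelayProtocol m n) (p : ℝ) :
    P.errorProb p = ∑ θ : Bool, 1 / 2 * ∑ y, prefixLaw p (P.strategy θ) θ m n y *
      (if P.decode y ≠ θ then 1 else 0) := by
  refine Finset.sum_congr rfl fun θ _ => ?_
  rw [← sum_noiseWeight_mul_nodeReceived p (P.strategy θ) θ m, Finset.mul_sum,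
    ← Equiv.sum_comp (Equiv.piComm fun (_ : Fin m) (_ : Fin n) => Bool)]
  refine Finset.sum_congr rfl fun e _ => ?_
  rw [mul_assoc, estimate, received_eq_nodeReceived, Finset.prod_comm]
  rfl

end RelayProtocol

theorem one_sub_sum_abs_sub_le {β : Type*} [Fintype β] {μ : β → ℝ} (hμ : ∑ y, μ y = 1)
    (ν : β → ℝ) (d : β → Bool) :
    1 - ∑ y, |μ y - ν y| ≤
      ∑ y, μ y * (if d y ≠ true then 1 else 0) + ∑ y, ν y * (if d y ≠ false then 1 else 0) := by
  calc 1 - ∑ y, |μ y - ν y| = ∑ y, (μ y - |μ y - ν y|) := by rw [Finset.sum_sub_distrib, hμ]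
    _ ≤ ∑ y, (μ y * (if d y ≠ true then 1 else 0) + ν y * (if d y ≠ false then 1 else 0)) := by
      refine Finset.sum_le_sum fun y _ => ?_
      cases d y
      · simp
      · simpa using sub_le_comm.1 (le_abs_self (μ y - ν y))
    _ = _ := Finset.sum_add_distrib

theorem RelayProtocol.pow_le_of_errorProb_le {m n : ℕ} (P : RelayProtocol m n) {p : ℝ}
    (hp₀ : 0 ≤ p) (hp₂ : p ≤ 1 / 2) (hP : P.errorProb p ≤ 1 / 3) :
    (1 + p) ^ m ≤ 9 * (1 + p - 2 * p ^ 2) ^ n := by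
  have hy : 1 ≤ (1 + p - 2 * p ^ 2) ^ n := one_le_pow₀ (by nlinarith)
  cases m with
  | zero => linarith
  | succ j =>
    have htest := one_sub_sum_abs_sub_le (sum_prefixLaw p (P.strategy true) true (j + 1) n)
      (prefixLaw p (P.strategy false) false (j + 1) n) P.decode
    have hnorm := prefixNorm_prefixLaw_sub_le hp₀ hp₂ (r := P.strategy true)
      (r' := P.strategy false) (fun _ => rfl) true false j n
    rw [P.errorProb_eq_sum_prefixLaw, Fintype.sum_bool] at hP
    simp only [prefixNorm, Pi.sub_apply] at hnorm
    have hdist : 1 / 6 ≤ (1 / (1 + p)) ^ j * (1 + p - 2 * p ^ 2) ^ n := by linarith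
    calc (1 + p) ^ (j + 1) = 6 * (1 + p) * ((1 + p) ^ j * (1 / 6)) := by ring
      _ ≤ 6 * (1 + 1 / 2) * ((1 + p) ^ j * ((1 / (1 + p)) ^ j * (1 + p - 2 * p ^ 2) ^ n)) := by
        gcongr
      _ = 9 * (1 + p - 2 * p ^ 2) ^ n := by
        rw [← mul_assoc ((1 + p) ^ j), ← mul_pow, mul_one_div_cancel (by positivity), one_pow]
        ring

end Converse

section Velocity

theorem le_lowerVelocity_of_eventually {p v : ℝ} (h : ∀ᶠ m : ℕ in Filter.atTop, ∃ n : ℕ,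
    (∃ P : RelayProtocol m n, P.errorProb p ≤ 1 / 3) ∧ v * n ≤ m) :
    ENNReal.ofReal v ≤ lowerVelocity p := by
  refine Filter.le_liminf_of_le (by isBoundedDefault) ?_
  filter_upwards [h, Filter.eventually_ne_atTop 0] with m ⟨n, hP, hn⟩ hm
  have hle : (minBlockLength m p : ℝ≥0∞) ≤ n := by
    exact_mod_cast ENat.toENNReal_le.2 (iInf₂_le n hP)
  calc ENNReal.ofReal v ≤ (m : ℝ≥0∞) / n := by
        rw [ENNReal.le_div_iff_mul_le (Or.inr (Nat.cast_ne_zero.2 hm))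
          (Or.inl (ENNReal.natCast_ne_top n)), ← ENNReal.ofReal_natCast n,
          ← ENNReal.ofReal_natCast m, ← ENNReal.ofReal_mul' n.cast_nonneg]
        exact ENNReal.ofReal_le_ofReal hn
    _ ≤ (m : ℝ≥0∞) / (minBlockLength m p : ℝ≥0∞) := ENNReal.div_le_div_left hle _

theorem minBlockLength_eq_top_or (m : ℕ) (p : ℝ) : minBlockLength m p = ⊤ ∨
    ∃ n : ℕ, (∃ P : RelayProtocol m n, P.errorProb p ≤ 1 / 3) ∧ minBlockLength m p = n := by
  classical
  by_cases h : ∃ n : ℕ, ∃ P : RelayProtocol m n, P.errorProb p ≤ 1 / 3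
  · exact Or.inr ⟨Nat.find h, Nat.find_spec h, le_antisymm (iInf₂_le (Nat.find h) (Nat.find_spec h))
      (le_iInf₂ fun _ hn => Nat.cast_le.2 (Nat.find_min' h hn))⟩
  · exact Or.inl (by simpa [minBlockLength] using h)

theorem upperVelocity_le_of_eventually {p v : ℝ} (h : ∀ᶠ m : ℕ in Filter.atTop, ∀ n : ℕ,
    (∃ P : RelayProtocol m n, P.errorProb p ≤ 1 / 3) → m ≤ v * n) :
    upperVelocity p ≤ ENNReal.ofReal v := by
  refine Filter.limsup_le_of_le (by isBoundedDefault) ?_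
  filter_upwards [h] with m hm
  rcases minBlockLength_eq_top_or m p with htop | ⟨n, hP, hn⟩
  · simp [htop]
  · refine ENNReal.div_le_of_le_mul ?_
    rw [hn, ENat.toENNReal_coe, ← ENNReal.ofReal_natCast n, ← ENNReal.ofReal_natCast m,
      ← ENNReal.ofReal_mul' n.cast_nonneg]
    exact ENNReal.ofReal_le_ofReal (hm n hP)

theorem le_lowerVelocity {p : ℝ} (hp : 0 < p) : ENNReal.ofReal (1 - 864 * p) ≤ lowerVelocity p := by
  rcases le_total (1 - 864 * p) 0 with hv | hv
  · rw [ENNReal.ofReal_of_nonpos hv]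
    exact zero_le
  · refine le_lowerVelocity_of_eventually ?_
    filter_upwards [eventually_exists_protocol hp (by linarith)] with m ⟨n, hP, hn⟩
    refine ⟨n, hP, ?_⟩
    calc (1 - 864 * p) * n ≤ (1 - 864 * p) * ((1 + 864 * p) * m) := by gcongr
      _ = (1 - (864 * p) ^ 2) * m := by ring
      _ ≤ m := mul_le_of_le_one_left m.cast_nonneg (sub_le_self 1 (sq_nonneg _))

theorem eventually_le_of_pow_le_mul_pow {x y s C : ℝ} (hx : 0 < x) (hy : 1 ≤ y) (hs : 0 < s)
    (hC : 0 ≤ C) (hxy : y < x ^ s) :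
    ∀ᶠ m : ℕ in Filter.atTop, ∀ n : ℕ, x ^ m ≤ C * y ^ n → m ≤ s * n := by
  set ρ := y ^ (1 / s) with hρ
  have hρx : ρ < x := by
    rw [hρ, one_div, Real.rpow_inv_lt_iff_of_pos (by positivity) hx.le hs]
    exact hxy
  have hlim : Filter.Tendsto (fun m : ℕ => C * (ρ / x) ^ m) Filter.atTop (nhds (C * 0)) :=
    (tendsto_pow_atTop_nhds_zero_of_lt_one (by positivity) ((div_lt_one hx).2 hρx)).const_mul C
  rw [mul_zero] at hlim
  filter_upwards [hlim.eventually_lt_const one_pos] with m hm n hn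
  by_contra! hlt
  have hpow : y ^ n ≤ ρ ^ m := by
    rw [hρ, ← Real.rpow_natCast y, ← Real.rpow_mul_natCast (by positivity)]
    refine Real.rpow_le_rpow_of_exponent_le hy ?_
    rw [one_div_mul_eq_div, le_div_iff₀' hs]
    exact hlt.le
  rw [div_pow, ← mul_div_assoc, div_lt_one (by positivity)] at hm
  exact (hn.trans (mul_le_mul_of_nonneg_left hpow hC)).not_gt hm

theorem one_add_sub_two_mul_sq_lt_rpow {p : ℝ} (hp₀ : 0 < p) (hp₁ : p ≤ 1) :
    1 + p - 2 * p ^ 2 < (1 + p) ^ (1 - p) := by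
  have hbernoulli : (1 + p) ^ p ≤ 1 + p * p :=
    rpow_one_add_le_one_add_mul_self (by linarith) hp₀.le hp₁
  rw [Real.rpow_sub (by positivity), Real.rpow_one, lt_div_iff₀ (by positivity)]
  calc (1 + p - 2 * p ^ 2) * (1 + p) ^ p ≤ (1 + p - 2 * p ^ 2) * (1 + p * p) := by
        gcongr
        nlinarith
    _ = 1 + p - p ^ 2 * (1 - p + 2 * p ^ 2) := by ring
    _ < 1 + p := sub_lt_self _ (mul_pos (by positivity) (by nlinarith))

theorem upperVelocity_le {p : ℝ} (hp₀ : 0 < p) (hp₂ : p ≤ 1 / 2) :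
    upperVelocity p ≤ ENNReal.ofReal (1 - p) := by
  have hrate := one_add_sub_two_mul_sq_lt_rpow hp₀ (by linarith)
  refine upperVelocity_le_of_eventually ?_
  filter_upwards [eventually_le_of_pow_le_mul_pow (by positivity) (by nlinarith) (by linarith)
    (Nat.ofNat_nonneg 9) hrate] with m hm n ⟨P, hP⟩
  exact hm n (P.pow_le_of_errorProb_le hp₀.le hp₂ hP)

end Velocity

theorem theorem2 :
    ∃ a b p₀ : ℝ, 0 < a ∧ 0 < b ∧ 0 < p₀ ∧ p₀ ≤ 1 / 2 ∧
      ∀ p : ℝ, 0 < p → p < p₀ →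
        ENNReal.ofReal (1 - b * p) ≤ lowerVelocity p ∧
        lowerVelocity p ≤ upperVelocity p ∧
        upperVelocity p ≤ ENNReal.ofReal (1 - a * p) := by
  refine ⟨1, 864, 1 / 2, one_pos, by norm_num, by norm_num, le_rfl, fun p hp₀ hp₂ =>
    ⟨le_lowerVelocity hp₀, Filter.liminf_le_limsup, ?_⟩⟩
  rw [one_mul]
  exact upperVelocity_le hp₀ hp₂.le
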